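/- **Setting.** Let $f:\mathbb R^d\to\mathbb R$ be convex, let $x_0\in\mathbb R^d$, $\eta_0>0$, $\rho\ge 0$, and let $T\ge 1$. AdaGrad++ starts from $x_0$ with step size $\eta_0$ and, given stochastic gradients $g_0,g_1,\dots$, computes (squares and roots of vectors are entrywise) $$s_t=\Big(\sum_{k=0}^t g_k^2\Big)^{1/2},\qquad x_{t+1}=x_t-\eta_t\,(\rho I+\operatorname{diag}(s_t))^{-1}g_t,\qquad \eta_{t+1}=\max\big(\eta_t,\ \|x_{t+1}-x_0\|_2/\sqrt d\big),$$ where a coordinate with $\rho+s_{t,i}=0$ is left unchanged. For each $t<T$, the vector $g_t$ is the answer of a stochastic subgradient oracle at $x_t$: conditionally on the information available before that query its mean lies in $\partial f(x_t)$, and $\|g_t\|_2\le l(x_t)$ almost surely, where $l:\mathbb R^d\to\mathbb R$ is continuous. Suppose that $l(x)\le G$ for all $x$ (the Lipschitz case). **Claim.** There is a universal constant $C>0$ such that in this setting, for every $\delta\in(0,1)$ and every $x_*\in\mathbb R^d$, with probability at least $1-\delta$ the following holds for every $\tau\in\arg\max_{t\le T}\sum_{i=0}^{t-1}\eta_i/\eta_t$.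 With $\bar x_\tau=\sum_{t<\tau}\eta_t x_t\big/\sum_{t<\tau}\eta_t$ and $D_\tau=\max_{t\le\tau}\|x_t-x_*\|_\infty$, $$f(\bar x_\tau)-f(x_*)\ \le\ \frac{C}{\eta_0}\,\log\!\Big(\frac{60\log(6\tau)}{\delta}\Big)\Big(1+\log\frac{\eta_T}{\eta_0}\Big)\cdot \max(D_\tau,\eta_0)^2\,\Big(G+\rho\sqrt{d/T}\Big)\sqrt{\frac dT}.$$ (When $\eta_0\le D_\tau$ and $\rho\sqrt{d/T}\le G$, that is, for small input parameters $\eta_0$ and $\rho$, this is the rate $\tilde O\big(D_\tau^2\,G\sqrt{d/T}\big)$, the hidden factors being the two displayed logarithms and $1/\eta_0$.) -/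

import Mathlib

open MeasureTheory ProbabilityTheory

namespace AdaGradPP

noncomputable section

/-- `ℝᵈ` with the Euclidean norm. -/
abbrev E (d : ℕ) : Type := EuclideanSpace ℝ (Fin d)

/-- The subdifferential of `f` at `x`. -/
def subdifferential {d : ℕ} (f : E d → ℝ) (x : E d) : Set (E d) :=
  {v | ∀ y, f x + inner ℝ v (y - x) ≤ f y}

/-- `ℓ∞` norm of a vector of `ℝᵈ` (the norm of `Fin d → ℝ` is the maximum of the `|v i|`). -/
def linfNorm {d : ℕ} (v : E d) : ℝ := ‖WithLp.ofLp v‖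

/-- Coordinate `i` of `s_t = (∑_{k ≤ t} g_k²)^{1/2}` (entrywise operations). -/
def accum {d : ℕ} (g : ℕ → E d) (t : ℕ) (i : Fin d) : ℝ :=
  √(∑ k ∈ Finset.range (t + 1), (g k i) ^ 2)

/-- The pair `(x_t, η_t)` produced by AdaGrad++ from the initial point `x₀`, the initial step
size `η₀` and the regularizer `ρ`, when the stochastic gradients are `g_0, g_1, …`:
`x_{t+1} = x_t - η_t (ρ + diag s_t)⁻¹ g_t` and `η_{t+1} = max (η_t, ‖x_{t+1} - x₀‖₂ / √d)`. -/
def state {d : ℕ} (x₀ : E d) (η₀ ρ : ℝ) (g : ℕ → E d) : ℕ → E d × ℝ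
  | 0 => (x₀, η₀)
  | t + 1 =>
    let p := state x₀ η₀ ρ g t
    let x' : E d := WithLp.toLp 2 (fun i => p.1 i - p.2 * ((ρ + accum g t i)⁻¹ * g t i))
    (x', max p.2 (‖x' - x₀‖ / √(d : ℝ)))

/-- The iterate `x_t` of AdaGrad++. -/
def iterate {d : ℕ} (x₀ : E d) (η₀ ρ : ℝ) (g : ℕ → E d) (t : ℕ) : E d :=
  (state x₀ η₀ ρ g t).1

/-- The step size `η_t` of AdaGrad++. -/
def stepSize {d : ℕ} (x₀ : E d) (η₀ ρ : ℝ) (g : ℕ → E d) (t : ℕ) : ℝ :=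
  (state x₀ η₀ ρ g t).2

/-- `τ ∈ argmax_{t ≤ T} ∑_{i < t} η_i / η_t`. -/
def IsOutputIndex (η : ℕ → ℝ) (T τ : ℕ) : Prop :=
  τ ≤ T ∧ ∀ t ≤ T,
    ∑ i ∈ Finset.range t, η i / η t ≤ ∑ i ∈ Finset.range τ, η i / η τ

/-- The weighted average `(∑_{t < τ} η_t x_t) / ∑_{t < τ} η_t`. -/
def average {d : ℕ} (η : ℕ → ℝ) (x : ℕ → E d) (τ : ℕ) : E d :=
  (∑ t ∈ Finset.range τ, η t)⁻¹ • ∑ t ∈ Finset.range τ, η t • x t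

/-- `D_τ = max_{t ≤ τ} ‖x_t - x_*‖_∞`. -/
def maxDist {d : ℕ} (x : ℕ → E d) (xstar : E d) (τ : ℕ) : ℝ :=
  (Finset.range (τ + 1)).sup' Finset.nonempty_range_add_one (fun t => linfNorm (x t - xstar))

/-- `θ_{t,δ} = log (60 log (6 t) / δ)`. -/
def theta (t : ℕ) (δ : ℝ) : ℝ := Real.log (60 * Real.log (6 * (t : ℝ)) / δ)

/-- For `t < T`, the random vector `g t` is the answer of a stochastic subgradient oracle queried
at the random point `x t`; `ℱ t` is the information available when the query is made. The answer
is a subgradient in conditional expectation and its norm is at most `l (x t)`. -/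
structure IsOracleRun {Ω : Type*} {mΩ : MeasurableSpace Ω} {d : ℕ} (P : Measure Ω)
    (ℱ : Filtration ℕ mΩ) (f l : E d → ℝ) (T : ℕ) (x g : ℕ → Ω → E d) : Prop where
  measurable : ∀ t < T, StronglyMeasurable[ℱ (t + 1)] (g t)
  unbiased : ∀ t < T, ∀ᵐ ω ∂P, (P[g t | ℱ t]) ω ∈ subdifferential f (x t ω)
  bounded : ∀ t < T, ∀ᵐ ω ∂P, ‖g t ω‖ ≤ l (x t ω)

end

end AdaGradPP

/-! By convexity the gap at the weighted average, times the total weight `W = ∑ η_t`, is at most `∑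
η_t ⟨v_t, x_t - x_*⟩`, where `v_t` is the conditional mean of `g_t`. This sum is a regret against
`g_t` minus a noise term.

Regret (`weighted_regret_le`): weighting by `η_t` cancels the step size in the quadratic potential,
so only the preconditioner varies in the telescoping. The cost is of order `(D² + η_τ²)(ρ d + G
√(dτ))`.

Noise: divide `x_t - x_*` by the nondecreasing scale `w_t = √d · D_t`. The resulting martingale has
bounded increments, and its partial sums are controlled uniformly in time
(`measure_exists_abs_sum_sub_condExp_le`), as the random index `τ` requires. The weights `η_t w_t`
are restored by summation by parts, at the price of their last value only.

Weight: `η` can grow by a factor `e` only about `log (η_T/η₀)` times, so the choice of `τ` gives `W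
≥ η_τ T / (6L)` with `L = 1 + log (η_T/η₀)`, provided `L ≤ T` (`exists_sum_div_ge`); otherwise `W ≥
η₀ τ` is enough. Since `η_τ ≤ 2 max(D_τ, η₀)`, division by `W` gives the rate (`le_rate_of_mul_le`).
-/

namespace AdaGradPP

/-! ### Deterministic inequalities for scalar sequences. -/

/-- One coordinate of the weighted regret bound for diagonal AdaGrad with step sizes at most `N`
and iterates within distance `D` of the comparator. -/
lemma sum_mul_le_of_adagrad_step (u g η : ℕ → ℝ) {ρ D N : ℝ} (hρ : 0 ≤ ρ)
    (hu : ∀ t, u (t + 1) =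
      u t - η t * ((ρ + √(∑ k ∈ Finset.range (t + 1), g k ^ 2))⁻¹ * g t)) (n : ℕ)
    (hD : ∀ t ≤ n, |u t| ≤ D) (hη : ∀ t < n, 0 ≤ η t ∧ η t ≤ N) :
    ∑ t ∈ Finset.range n, η t * (g t * u t) ≤
      1 / 2 * D ^ 2 * (ρ + √(∑ k ∈ Finset.range n, g k ^ 2)) +
        N ^ 2 * √(∑ k ∈ Finset.range n, g k ^ 2) -
        1 / 2 * (ρ + √(∑ k ∈ Finset.range n, g k ^ 2)) * u n ^ 2 := by
  -- The final negative term of the bound is the potential that the induction carries.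
  induction n with
  | zero =>
    have h0 : u 0 ^ 2 ≤ D ^ 2 := sq_le_sq' (by linarith [abs_le.1 (hD 0 le_rfl)])
      (abs_le.1 (hD 0 le_rfl)).2
    simp only [Finset.range_zero, Finset.sum_empty, Real.sqrt_zero]
    nlinarith
  | succ n ih =>
    have ih := ih (fun t ht => hD t (by omega)) (fun t ht => hη t (by omega))
    rw [Finset.sum_range_succ]
    have hsum : ∑ k ∈ Finset.range (n + 1), g k ^ 2 = ∑ k ∈ Finset.range n, g k ^ 2 + g n ^ 2 :=
      Finset.sum_range_succ _ _
    have hS : 0 ≤ ∑ k ∈ Finset.range n, g k ^ 2 := Finset.sum_nonneg fun _ _ => sq_nonneg _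
    have hun := hu n
    set A := √(∑ k ∈ Finset.range n, g k ^ 2) with hA
    set A' := √(∑ k ∈ Finset.range (n + 1), g k ^ 2) with hA'
    have hA0 : 0 ≤ A := Real.sqrt_nonneg _
    have hAA : A ≤ A' := Real.sqrt_le_sqrt (by rw [hsum]; nlinarith [sq_nonneg (g n)])
    have hsq : A' ^ 2 = A ^ 2 + g n ^ 2 := by
      rw [hA, hA', Real.sq_sqrt hS, Real.sq_sqrt (by positivity), hsum]
    obtain ⟨hη0, hηN⟩ := hη n (by omega)
    have hun2 : u n ^ 2 ≤ D ^ 2 := sq_le_sq' (by linarith [abs_le.1 (hD n (by omega))])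
      (abs_le.1 (hD n (by omega))).2
    have hηsq : η n ^ 2 ≤ N ^ 2 := by nlinarith
    have key : η n * (g n * u n) ≤ 1 / 2 * (ρ + A') * u n ^ 2 - 1 / 2 * (ρ + A') * u (n + 1) ^ 2
        + N ^ 2 * (A' - A) := by
      -- If the denominator vanishes then so does the gradient, and the step is trivial.
      rcases eq_or_lt_of_le (add_nonneg hρ (hA0.trans hAA)) with h | h
      · have hA'0 : A' = 0 := by linarith
        have hg : g n = 0 := by
          have : g n ^ 2 ≤ 0 := by nlinarith
          nlinarith [sq_nonneg (g n)]
        rw [← h, hg]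
        nlinarith [mul_nonneg (sq_nonneg N) (sub_nonneg.2 hAA)]
      -- `g_n² = A'² - A² = (A' - A)(A' + A)`, and both `A` and `A'` are at most `ρ + A'`.
      · have hgh : g n ^ 2 ≤ 2 * (A' - A) * (ρ + A') := by nlinarith
        have hq : (ρ + A')⁻¹ * g n ^ 2 ≤ 2 * (A' - A) := by
          rw [inv_mul_le_iff₀ h]; linarith
        have hq0 : 0 ≤ (ρ + A')⁻¹ * g n ^ 2 := by positivity
        have expand : 1 / 2 * (ρ + A') * u (n + 1) ^ 2 = 1 / 2 * (ρ + A') * u n ^ 2 -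
            η n * (g n * u n) + 1 / 2 * η n ^ 2 * ((ρ + A')⁻¹ * g n ^ 2) := by
          rw [hun]; field_simp; ring
        rw [expand]
        nlinarith [mul_le_mul hηsq hq hq0 (sq_nonneg N)]
    -- Raising the weight of the potential from `A` to `A'` costs `(A' - A) u_n² / 2 ≤ (A' - A) D² /
    -- 2`, which telescopes.
    nlinarith [mul_nonneg (sub_nonneg.2 hAA) (sub_nonneg.2 hun2)]

/-- Summation by parts for nonnegative nondecreasing weights. -/
lemma abs_sum_mul_le_of_monotone {y X : ℕ → ℝ} {B : ℝ} (hy : Monotone y) (hy0 : 0 ≤ y 0) (n : ℕ)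
    (hB : ∀ s ≤ n, |∑ i ∈ Finset.range s, X i| ≤ B) :
    |∑ i ∈ Finset.range n, y i * X i| ≤ 2 * y n * B := by
  have key : ∀ m ≤ n, |∑ i ∈ Finset.range m, y i * X i - y m * ∑ i ∈ Finset.range m, X i| ≤
      (y m - y 0) * B := by
    intro m
    induction m with
    | zero => simp
    | succ m ih =>
      intro hm
      have h1 := ih (by omega)
      have h2 : |(y (m + 1) - y m) * ∑ i ∈ Finset.range (m + 1), X i| ≤ (y (m + 1) - y m) * B := by
        have h0 := sub_nonneg.2 (hy (Nat.le_succ m))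
        rw [abs_mul, abs_of_nonneg h0]
        exact mul_le_mul_of_nonneg_left (hB _ hm) h0
      calc _ = |(∑ i ∈ Finset.range m, y i * X i - y m * ∑ i ∈ Finset.range m, X i) -
            (y (m + 1) - y m) * ∑ i ∈ Finset.range (m + 1), X i| := by
            rw [Finset.sum_range_succ, Finset.sum_range_succ]; ring_nf
        _ ≤ _ := (abs_sub _ _).trans (by linarith)
  have h1 := key n le_rfl
  have hyn : 0 ≤ y n := hy0.trans (hy (Nat.zero_le n))
  have h2 : |y n * ∑ i ∈ Finset.range n, X i| ≤ y n * B := by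
    rw [abs_mul, abs_of_nonneg hyn]
    exact mul_le_mul_of_nonneg_left (hB _ le_rfl) hyn
  have hB0 : 0 ≤ B := (abs_nonneg _).trans (hB n le_rfl)
  have h3 := abs_add_le (∑ i ∈ Finset.range n, y i * X i - y n * ∑ i ∈ Finset.range n, X i)
    (y n * ∑ i ∈ Finset.range n, X i)
  rw [sub_add_cancel] at h3
  nlinarith [mul_nonneg hy0 hB0]

/-- Among `T ≥ L` steps of a positive nondecreasing sequence `η`, where
`L = 1 + log (η T / η 0)`, some prefix has total at least `T / (6 L)` times its last term. -/
lemma exists_sum_div_ge {η : ℕ → ℝ} (hη : Monotone η) (h0 : 0 < η 0) {T : ℕ}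
    (hT : 1 + Real.log (η T / η 0) ≤ T) :
    ∃ t ≤ T, (T : ℝ) / (6 * (1 + Real.log (η T / η 0))) ≤ ∑ i ∈ Finset.range t, η i / η t := by
  have hpos : ∀ t, 0 < η t := fun t => h0.trans_le (hη (Nat.zero_le t))
  set Λ := Real.log (η T / η 0) with hΛ
  have hΛ0 : 0 ≤ Λ := Real.log_nonneg ((one_le_div h0).2 (hη (Nat.zero_le T)))
  -- Cut the first `K n ≤ T` steps into `K` blocks of length `n`. Growth by more than `e` on each
  -- would force `η_T > e^K η₀ ≥ e^Λ η₀ = η_T`. On a block without such growth, every ratio to the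
  -- right endpoint is at least `1/e ≥ 1/3`.
  set K : ℕ := ⌊Λ⌋₊ + 1 with hK
  have hKL : (K : ℝ) ≤ 1 + Λ := by
    rw [hK]; push_cast; linarith [Nat.floor_le hΛ0]
  have hΛK : Λ ≤ K := by rw [hK]; push_cast; exact (Nat.lt_floor_add_one Λ).le
  have hKT : K ≤ T := by exact_mod_cast hKL.trans hT
  set n : ℕ := T / K with hn
  have hn1 : 1 ≤ n := (Nat.one_le_div_iff (by omega)).2 hKT
  have hTn : T ≤ 2 * n * K := by
    have := Nat.lt_div_mul_add (a := T) (b := K) (by omega)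
    nlinarith
  have hnK : K * n ≤ T := by rw [mul_comm]; exact Nat.div_mul_le_self T K
  obtain ⟨j, hj, hjη⟩ : ∃ j < K, η ((j + 1) * n) ≤ Real.exp 1 * η (j * n) := by
    by_contra! hcon
    have hgrow : ∀ j ≤ K, Real.exp j * η 0 ≤ η (j * n) ∧ (0 < j → Real.exp j * η 0 < η (j * n)) := by
      intro j
      induction j with
      | zero => simp
      | succ j ih =>
        intro hj
        have h1 := (ih (by omega)).1
        have h2 := hcon j (by omega)
        have h3 : Real.exp ((j + 1 : ℕ) : ℝ) * η 0 < η ((j + 1) * n) := by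
          push_cast
          rw [add_comm, Real.exp_add, mul_assoc]
          exact (mul_le_mul_of_nonneg_left h1 (Real.exp_pos 1).le).trans_lt h2
        exact ⟨h3.le, fun _ => h3⟩
    have h1 := (hgrow K le_rfl).2 (by omega)
    have h2 : η T = Real.exp Λ * η 0 := by
      rw [hΛ, Real.exp_log (div_pos (hpos T) h0), div_mul_cancel₀ _ h0.ne']
    have h3 : Real.exp Λ * η 0 ≤ Real.exp K * η 0 :=
      mul_le_mul_of_nonneg_right (Real.exp_le_exp.2 hΛK) h0.le
    linarith [hη hnK]
  have hjT : (j + 1) * n ≤ T := (Nat.mul_le_mul_right n hj).trans hnK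
  refine ⟨(j + 1) * n, hjT, ?_⟩
  have he : Real.exp 1 ≤ 3 := by linarith [Real.exp_one_lt_d9]
  have hlow : (n : ℝ) / 3 ≤ ∑ i ∈ Finset.range ((j + 1) * n), η i / η ((j + 1) * n) := by
    have hsub : Finset.Ico (j * n) ((j + 1) * n) ⊆ Finset.range ((j + 1) * n) := by
      intro i hi; simp only [Finset.mem_Ico, Finset.mem_range] at hi ⊢; exact hi.2
    refine le_trans ?_ (Finset.sum_le_sum_of_subset_of_nonneg hsub
      fun i _ _ => (div_pos (hpos _) (hpos _)).le)
    have hcard : (Finset.Ico (j * n) ((j + 1) * n)).card = n := by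
      rw [Nat.card_Ico, add_mul, one_mul]; omega
    have := Finset.card_nsmul_le_sum (Finset.Ico (j * n) ((j + 1) * n))
      (fun i => η i / η ((j + 1) * n)) (1 / 3) (fun i hi => by
        rw [div_le_div_iff₀ (by norm_num) (hpos _)]
        nlinarith [hη (Finset.mem_Ico.1 hi).1, hpos (j * n)])
    rw [hcard, nsmul_eq_mul] at this
    linarith
  refine le_trans ?_ hlow
  rw [div_le_div_iff₀ (by linarith) (by norm_num)]
  have hTn' : (T : ℝ) ≤ 2 * n * K := by exact_mod_cast hTn
  have hn0 : (0 : ℝ) ≤ n := Nat.cast_nonneg n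
  nlinarith

variable {d : ℕ}

/-! ### Regret of the AdaGrad++ recursion. -/

lemma iterate_succ_apply (x₀ : E d) (η₀ ρ : ℝ) (g : ℕ → E d) (t : ℕ) (i : Fin d) :
    iterate x₀ η₀ ρ g (t + 1) i =
      iterate x₀ η₀ ρ g t i - stepSize x₀ η₀ ρ g t * ((ρ + accum g t i)⁻¹ * g t i) := rfl

lemma stepSize_succ (x₀ : E d) (η₀ ρ : ℝ) (g : ℕ → E d) (t : ℕ) :
    stepSize x₀ η₀ ρ g (t + 1) =
      max (stepSize x₀ η₀ ρ g t) (‖iterate x₀ η₀ ρ g (t + 1) - x₀‖ / √(d : ℝ)) := rfl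

lemma monotone_stepSize (x₀ : E d) (η₀ ρ : ℝ) (g : ℕ → E d) :
    Monotone (stepSize x₀ η₀ ρ g) :=
  monotone_nat_of_le_succ fun t => by rw [stepSize_succ]; exact le_max_left _ _

lemma abs_apply_le_linfNorm (v : E d) (i : Fin d) : |v i| ≤ linfNorm v :=
  norm_le_pi_norm (WithLp.ofLp v) i

lemma linfNorm_nonneg (v : E d) : 0 ≤ linfNorm v := norm_nonneg _

lemma norm_le_sqrt_mul_linfNorm (v : E d) : ‖v‖ ≤ √(d : ℝ) * linfNorm v := by
  rw [EuclideanSpace.norm_eq, ← Real.sqrt_sq (linfNorm_nonneg v),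
    ← Real.sqrt_mul (Nat.cast_nonneg d)]
  refine Real.sqrt_le_sqrt ?_
  have := Finset.sum_le_card_nsmul Finset.univ (fun i => ‖v i‖ ^ 2) (linfNorm v ^ 2) (fun i _ => by
    have := abs_apply_le_linfNorm v i
    rw [Real.norm_eq_abs]
    gcongr)
  simpa using this

lemma linfNorm_sub_le_maxDist (x : ℕ → E d) (xstar : E d) {t τ : ℕ} (h : t ≤ τ) :
    linfNorm (x t - xstar) ≤ maxDist x xstar τ :=
  Finset.le_sup' (fun t => linfNorm (x t - xstar)) (Finset.mem_range.2 (by omega))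

lemma monotone_maxDist (x : ℕ → E d) (xstar : E d) : Monotone (maxDist x xstar) :=
  fun _ _ h => Finset.sup'_le _ _ fun _ ht =>
    linfNorm_sub_le_maxDist x xstar ((Nat.lt_succ_iff.1 (Finset.mem_range.1 ht)).trans h)

lemma maxDist_nonneg (x : ℕ → E d) (xstar : E d) (τ : ℕ) : 0 ≤ maxDist x xstar τ :=
  (linfNorm_nonneg _).trans (linfNorm_sub_le_maxDist x xstar (Nat.zero_le τ))

/-- Triangle inequality through `xstar`: both `x_t` and `x₀` lie within `√d · D_t` of it in
Euclidean norm, which explains the factor 2. -/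
lemma stepSize_le (x₀ : E d) {η₀ : ℝ} (ρ : ℝ) (g : ℕ → E d) (xstar : E d) (t : ℕ) :
    stepSize x₀ η₀ ρ g t ≤ max η₀ (2 * maxDist (iterate x₀ η₀ ρ g) xstar t) := by
  induction t with
  | zero => exact le_max_left _ _
  | succ t ih =>
    rw [stepSize_succ]
    refine max_le (ih.trans (max_le_max le_rfl ?_)) (le_max_of_le_right ?_)
    · exact mul_le_mul_of_nonneg_left (monotone_maxDist _ _ (Nat.le_succ t)) zero_le_two
    · have h1 : ‖iterate x₀ η₀ ρ g (t + 1) - x₀‖ ≤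
          √(d : ℝ) * (2 * maxDist (iterate x₀ η₀ ρ g) xstar (t + 1)) := by
        have h2 := linfNorm_sub_le_maxDist (iterate x₀ η₀ ρ g) xstar (le_refl (t + 1))
        have h3 := linfNorm_sub_le_maxDist (iterate x₀ η₀ ρ g) xstar (Nat.zero_le (t + 1))
        have h4 := norm_le_sqrt_mul_linfNorm (iterate x₀ η₀ ρ g (t + 1) - xstar)
        have h5 := norm_le_sqrt_mul_linfNorm (iterate x₀ η₀ ρ g 0 - xstar)
        have h6 : ‖iterate x₀ η₀ ρ g (t + 1) - x₀‖ ≤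
            ‖iterate x₀ η₀ ρ g (t + 1) - xstar‖ + ‖iterate x₀ η₀ ρ g 0 - xstar‖ :=
          norm_sub_le_norm_sub_add_norm_sub _ xstar x₀ |>.trans (by
            rw [norm_sub_rev xstar x₀]; rfl)
        nlinarith [Real.sqrt_nonneg (d : ℝ)]
      refine div_le_of_le_mul₀ (Real.sqrt_nonneg _) ?_ (by linarith)
      have := maxDist_nonneg (iterate x₀ η₀ ρ g) xstar (t + 1)
      linarith

/-- Cauchy–Schwarz over the coordinates; exchanging the sums then leaves `∑ ‖g_k‖² ≤ n G²`. -/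
lemma sum_sqrt_sum_sq_le (g : ℕ → E d) {G : ℝ} (n : ℕ) (hg : ∀ t < n, ‖g t‖ ≤ G) (hG : 0 ≤ G) :
    ∑ i, √(∑ k ∈ Finset.range n, g k i ^ 2) ≤ √(d : ℝ) * G * √(n : ℝ) := by
  have h1 := Real.sum_sqrt_mul_sqrt_le (Finset.univ : Finset (Fin d)) (f := fun _ => 1)
    (g := fun i => ∑ k ∈ Finset.range n, g k i ^ 2) (fun _ => zero_le_one)
    (fun i => Finset.sum_nonneg fun _ _ => sq_nonneg _)
  simp only [Real.sqrt_one, one_mul, Finset.sum_const, Finset.card_univ, Fintype.card_fin,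
    nsmul_eq_mul, mul_one] at h1
  refine h1.trans ?_
  rw [mul_assoc]
  refine mul_le_mul_of_nonneg_left ?_ (Real.sqrt_nonneg _)
  rw [Finset.sum_comm]
  have h2 : ∑ k ∈ Finset.range n, ∑ i, g k i ^ 2 ≤ G ^ 2 * n := by
    have := Finset.sum_le_card_nsmul (Finset.range n) (fun k => ∑ i, g k i ^ 2) (G ^ 2)
      (fun k hk => by
        rw [← EuclideanSpace.real_norm_sq_eq]
        have := hg k (Finset.mem_range.1 hk)
        gcongr)
    rw [Finset.card_range, nsmul_eq_mul] at this
    linarith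
  calc _ ≤ √(G ^ 2 * n) := Real.sqrt_le_sqrt h2
    _ = _ := by rw [Real.sqrt_mul (sq_nonneg G), Real.sqrt_sq hG]

/-- The weighted regret of AdaGrad++ against the stochastic gradients. -/
lemma weighted_regret_le (x₀ : E d) {η₀ ρ : ℝ} (g : ℕ → E d) (xstar : E d) {G : ℝ} (hη₀ : 0 < η₀)
    (hρ : 0 ≤ ρ) (hG : 0 ≤ G) (n : ℕ) (hg : ∀ t < n, ‖g t‖ ≤ G) :
    ∑ t ∈ Finset.range n, stepSize x₀ η₀ ρ g t * inner ℝ (g t) (iterate x₀ η₀ ρ g t - xstar) ≤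
      1 / 2 * maxDist (iterate x₀ η₀ ρ g) xstar n ^ 2 * (ρ * d + √(d : ℝ) * G * √(n : ℝ)) +
        stepSize x₀ η₀ ρ g n ^ 2 * (√(d : ℝ) * G * √(n : ℝ)) := by
  set D := maxDist (iterate x₀ η₀ ρ g) xstar n
  set N := stepSize x₀ η₀ ρ g n
  have hpos : ∀ t, 0 < stepSize x₀ η₀ ρ g t := fun t =>
    hη₀.trans_le (monotone_stepSize x₀ η₀ ρ g (Nat.zero_le t))
  have hcoord : ∀ i : Fin d, ∑ t ∈ Finset.range n, stepSize x₀ η₀ ρ g t *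
      (g t i * (iterate x₀ η₀ ρ g t i - xstar i)) ≤
      1 / 2 * D ^ 2 * ρ + (1 / 2 * D ^ 2 + N ^ 2) * √(∑ k ∈ Finset.range n, g k i ^ 2) := by
    intro i
    have h := sum_mul_le_of_adagrad_step (fun t => iterate x₀ η₀ ρ g t i - xstar i)
      (fun t => g t i) (stepSize x₀ η₀ ρ g) (D := D) (N := N) hρ
      (fun t => by rw [iterate_succ_apply, accum]; ring) n
      (fun t ht => (abs_apply_le_linfNorm (iterate x₀ η₀ ρ g t - xstar) i).trans
        (linfNorm_sub_le_maxDist _ _ ht))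
      (fun t ht => ⟨(hpos t).le, monotone_stepSize x₀ η₀ ρ g ht.le⟩)
    have : 0 ≤ 1 / 2 * (ρ + √(∑ k ∈ Finset.range n, g k i ^ 2)) *
        (iterate x₀ η₀ ρ g n i - xstar i) ^ 2 := by positivity
    linarith
  have hsum := Finset.sum_le_sum fun i (_ : i ∈ Finset.univ) => hcoord i
  rw [Finset.sum_comm, Finset.sum_add_distrib, ← Finset.mul_sum, Finset.sum_const,
    Finset.card_univ, Fintype.card_fin, nsmul_eq_mul] at hsum
  have hlhs : ∀ t, stepSize x₀ η₀ ρ g t * inner ℝ (g t) (iterate x₀ η₀ ρ g t - xstar) =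
      ∑ i, stepSize x₀ η₀ ρ g t * (g t i * (iterate x₀ η₀ ρ g t i - xstar i)) := fun t => by
    rw [← Finset.mul_sum, PiLp.inner_apply]
    simp [mul_comm]
  simp_rw [hlhs]
  have := mul_le_mul_of_nonneg_left (sum_sqrt_sum_sq_le g n hg hG)
    (by positivity : 0 ≤ 1 / 2 * D ^ 2 + N ^ 2)
  rw [Finset.mul_sum] at this
  linarith

lemma sum_mul_sub_ge_of_average {f : E d → ℝ} (hf : ConvexOn ℝ Set.univ f) {η : ℕ → ℝ}
    (hη : ∀ t, 0 < η t) (x : ℕ → E d) {τ : ℕ} (hτ : 1 ≤ τ) (c : ℝ) :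
    (∑ t ∈ Finset.range τ, η t) * (f (average η x τ) - c) ≤
      ∑ t ∈ Finset.range τ, η t * (f (x t) - c) := by
  have hW : 0 < ∑ t ∈ Finset.range τ, η t :=
    Finset.sum_pos (fun t _ => hη t) (Finset.nonempty_range_iff.2 (by omega))
  have h := hf.map_centerMass_le (t := Finset.range τ) (w := η) (p := x) (fun t _ => (hη t).le) hW
    (fun _ _ => Set.mem_univ _)
  rw [Finset.centerMass, Finset.centerMass] at h
  have h2 : (∑ t ∈ Finset.range τ, η t) * f (average η x τ) ≤
      ∑ t ∈ Finset.range τ, η t * f (x t) := by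
    rw [average]
    refine (mul_le_mul_of_nonneg_left h hW.le).trans (le_of_eq ?_)
    rw [smul_eq_mul, mul_inv_cancel_left₀ hW.ne']
    simp
  simp_rw [mul_sub, Finset.sum_sub_distrib, ← Finset.sum_mul]
  linarith

end AdaGradPP

namespace AdaGradPP

/-! ### Time-uniform martingale concentration. -/

section Concentration

variable {Ω : Type*} {mΩ : MeasurableSpace Ω} {P : Measure Ω} [IsProbabilityMeasure P]
  {ℱ : Filtration ℕ mΩ}

lemma stronglyMeasurable_sum_range {X : ℕ → Ω → ℝ}
    (hX : ∀ i, StronglyMeasurable[ℱ (i + 1)] (X i)) (s : ℕ) :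
    StronglyMeasurable[ℱ s] (fun ω => ∑ i ∈ Finset.range s, X i ω) :=
  Finset.stronglyMeasurable_fun_sum _ fun i hi =>
    (hX i).mono (ℱ.mono (Finset.mem_range.1 hi))

/-- Maximal inequality for martingales with increments bounded by `1`. -/
lemma measure_exists_lt_sum_le {X : ℕ → Ω → ℝ}
    (hX : ∀ i, StronglyMeasurable[ℱ (i + 1)] (X i)) (hb : ∀ i, ∀ᵐ ω ∂P, |X i ω| ≤ 1)
    (hc : ∀ i, P[X i | ℱ i] =ᵐ[P] 0) {n : ℕ} (hn : 1 ≤ n) (u : ℝ) :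
    P {ω | ∃ s ≤ n, u * √(n : ℝ) < ∑ i ∈ Finset.range s, X i ω} ≤
      ENNReal.ofReal (Real.exp (1 - u)) := by
  have hn0 : (0 : ℝ) < n := by exact_mod_cast hn
  have hsn : 1 ≤ √(n : ℝ) := Real.one_le_sqrt.2 (by exact_mod_cast hn)
  -- With this exponent each step multiplies the mean of `exp (c ∑ X)` by at most `exp (1/n)`, so
  -- after `n` steps it is at most `e`: the source of the 1 in `exp (1 - u)`.
  set c : ℝ := (√(n : ℝ))⁻¹ with hcdef
  have hc0 : 0 < c := by positivity
  have hc1 : c ≤ 1 := inv_le_one_of_one_le₀ hsn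
  have hcsq : c ^ 2 = 1 / n := by rw [hcdef, inv_pow, Real.sq_sqrt hn0.le, one_div]
  set F : ℕ → Ω → ℝ := fun s ω => Real.exp (c * ∑ i ∈ Finset.range s, X i ω) with hF
  have hFsucc : ∀ s ω, F (s + 1) ω = F s ω * Real.exp (c * X s ω) := fun s ω => by
    simp only [hF]; rw [Finset.sum_range_succ, mul_add, Real.exp_add]
  have hFm : ∀ s, StronglyMeasurable[ℱ s] (F s) := fun s =>
    Real.continuous_exp.comp_stronglyMeasurable ((stronglyMeasurable_sum_range hX s).const_mul c)
  have hFpos : ∀ s ω, 0 < F s ω := fun s ω => Real.exp_pos _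
  have hFb : ∀ s, ∀ᵐ ω ∂P, ‖F s ω‖ ≤ Real.exp s := by
    intro s
    filter_upwards [ae_all_iff.2 hb] with ω hω
    rw [Real.norm_eq_abs, abs_of_pos (hFpos s ω)]
    refine Real.exp_le_exp.2 ?_
    have h1 : ∑ i ∈ Finset.range s, X i ω ≤ s := by
      have := Finset.sum_le_card_nsmul (Finset.range s) (fun i => X i ω) 1
        (fun i _ => (abs_le.1 (hω i)).2)
      simpa using this
    have hs0 : (0 : ℝ) ≤ s := Nat.cast_nonneg s
    nlinarith
  have hFi : ∀ s, Integrable (F s) P := fun s =>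
    Integrable.of_bound ((hFm s).mono (ℱ.le s)).aestronglyMeasurable _ (hFb s)
  have hXm : ∀ i, AEStronglyMeasurable (X i) P := fun i =>
    ((hX i).mono (ℱ.le _)).aestronglyMeasurable
  have hXi : ∀ i, Integrable (X i) P := fun i => Integrable.of_bound (hXm i) 1 (hb i)
  have hFX : ∀ s, Integrable (F s * X s) P := fun s =>
    (hXi s).bdd_mul ((hFm s).mono (ℱ.le s)).aestronglyMeasurable (hFb s)
  have hFX' : ∀ s, Integrable (fun ω => c * (F s ω * X s ω)) P := fun s => (hFX s).const_mul c
  have hcFX : ∀ s, P[F s * X s | ℱ s] =ᵐ[P] 0 := fun s => by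
    filter_upwards [condExp_mul_of_stronglyMeasurable_left (hFm s) (hFX s) (hXi s), hc s]
      with ω h1 h2
    rw [h1, Pi.mul_apply, h2]; simp
  have hIFX : ∀ s, ∫ ω, F s ω * X s ω ∂P = 0 := fun s => by
    have := integral_condExp (μ := P) (f := F s * X s) (ℱ.le s)
    rw [integral_congr_ae (hcFX s)] at this
    simpa using this.symm
  -- From `e^y ≥ 1 + y`, the linear term having zero conditional mean.
  have hsub : Submartingale F ℱ P := by
    refine submartingale_nat hFm hFi fun s => ?_
    have h1 : P[F s + c • (F s * X s) | ℱ s] =ᵐ[P] F s := by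
      filter_upwards [condExp_add (hFi s) ((hFX s).smul c) (ℱ s),
        condExp_smul (μ := P) c (F s * X s) (ℱ s), hcFX s] with ω h1 h2 h3
      rw [h1, Pi.add_apply, h2, Pi.smul_apply, h3,
        condExp_of_stronglyMeasurable (ℱ.le s) (hFm s) (hFi s)]
      simp
    refine h1.symm.le.trans
      (condExp_mono ((hFi s).add ((hFX s).smul c)) (hFi (s + 1)) (ae_of_all _ fun ω => ?_))
    simp only [Pi.add_apply, Pi.smul_apply, Pi.mul_apply, smul_eq_mul]
    rw [hFsucc]
    nlinarith [Real.add_one_le_exp (c * X s ω), hFpos s ω]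
  -- From `e^y ≤ 1 + y + y²` for `|y| ≤ 1`; the linear term integrates to zero and `y² ≤ 1/n`.
  have hstep : ∀ s, ∫ ω, F (s + 1) ω ∂P ≤ Real.exp (1 / n) * ∫ ω, F s ω ∂P := by
    intro s
    have h1 : ∫ ω, F (s + 1) ω ∂P ≤ ∫ ω, ((1 + 1 / n) * F s ω + c * (F s ω * X s ω)) ∂P := by
      refine integral_mono_ae (hFi (s + 1)) (((hFi s).const_mul _).add (hFX' s)) ?_
      filter_upwards [hb s] with ω hω
      have hx2 : (c * X s ω) ^ 2 ≤ 1 / n := by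
        rw [mul_pow, hcsq]
        have : X s ω ^ 2 ≤ 1 := by rw [← sq_abs]; nlinarith [abs_nonneg (X s ω)]
        have h0 : (0 : ℝ) ≤ 1 / n := by positivity
        nlinarith
      have h2 := abs_le.1 (Real.abs_exp_sub_one_sub_id_le (x := c * X s ω) (by
        rw [abs_mul, abs_of_pos hc0]; nlinarith [abs_nonneg (X s ω)]))
      rw [hFsucc]
      have h3 : Real.exp (c * X s ω) ≤ 1 + 1 / n + c * X s ω := by linarith [h2.2]
      nlinarith [hFpos s ω, mul_le_mul_of_nonneg_left h3 (hFpos s ω).le]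
    rw [integral_add ((hFi s).const_mul _) (hFX' s), integral_const_mul,
      integral_const_mul, hIFX, mul_zero, add_zero] at h1
    refine h1.trans (mul_le_mul_of_nonneg_right ?_ (integral_nonneg fun ω => (hFpos s ω).le))
    linarith [Real.add_one_le_exp (1 / n : ℝ)]
  have hint : ∀ s : ℕ, ∫ ω, F s ω ∂P ≤ Real.exp (s / n) := by
    intro s
    induction s with
    | zero => simp [hF]
    | succ s ih =>
      refine (hstep s).trans ((mul_le_mul_of_nonneg_left ih (Real.exp_pos _).le).trans
        (le_of_eq ?_))
      rw [← Real.exp_add]; congr 1; push_cast; ring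
  have hmax := maximal_ineq hsub (fun s ω => (hFpos s ω).le) (ε := (Real.exp u).toNNReal) n
  set A : Set Ω := {ω | ((Real.exp u).toNNReal : ℝ) ≤
    (Finset.range (n + 1)).sup' Finset.nonempty_range_add_one fun k => F k ω} with hA
  have hsubset : {ω | ∃ s ≤ n, u * √(n : ℝ) < ∑ i ∈ Finset.range s, X i ω} ⊆ A := by
    rintro ω ⟨s, hs, hlt⟩
    rw [hA, Set.mem_ofPred_eq, Real.coe_toNNReal _ (Real.exp_pos u).le]
    refine le_trans ?_ (Finset.le_sup' (fun k => F k ω) (Finset.mem_range.2 (by omega) :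
      s ∈ Finset.range (n + 1)))
    refine Real.exp_le_exp.2 ?_
    rw [hcdef, inv_mul_eq_div, le_div_iff₀ (by linarith)]
    exact hlt.le
  have hle : ENNReal.ofReal (∫ ω in A, F n ω ∂P) ≤ ENNReal.ofReal (Real.exp 1) := by
    refine ENNReal.ofReal_le_ofReal ((setIntegral_le_integral (hFi n)
      (ae_of_all _ fun ω => (hFpos n ω).le)).trans ((hint n).trans ?_))
    rw [div_self hn0.ne']
  refine (measure_mono hsubset).trans ?_
  have h : ENNReal.ofReal (Real.exp u) * P A ≤ _ := hmax.trans hle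
  rw [Real.exp_sub, ENNReal.ofReal_div_of_pos (Real.exp_pos u)]
  rw [ENNReal.le_div_iff_mul_le (Or.inl (by simp [Real.exp_pos])) (Or.inl ENNReal.ofReal_ne_top)]
  rwa [mul_comm]

lemma log_six_mul_ge {t : ℕ} (ht : 1 ≤ t) : 1 ≤ Real.log (6 * (t : ℝ)) := by
  have ht' : (1 : ℝ) ≤ t := by exact_mod_cast ht
  rw [Real.le_log_iff_exp_le (by positivity)]
  linarith [Real.exp_one_lt_d9]

lemma one_le_theta {t : ℕ} (ht : 1 ≤ t) {δ : ℝ} (hδ : 0 < δ) (hδ1 : δ < 1) : 1 ≤ theta t δ := by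
  have h := log_six_mul_ge ht
  rw [theta, Real.le_log_iff_exp_le (by positivity), le_div_iff₀ hδ]
  nlinarith [Real.exp_one_lt_d9, Real.exp_pos 1]

lemma two_pow_clog_le {t : ℕ} (ht : 1 ≤ t) : 2 ^ Nat.clog 2 t ≤ 2 * t := by
  rcases eq_or_lt_of_le ht with rfl | h
  · simp
  · have h1 := Nat.pow_pred_clog_lt_self (b := 2) (by norm_num) h
    have h2 : 1 ≤ Nat.clog 2 t := Nat.clog_pos (by norm_num) h
    obtain ⟨m, hm⟩ := Nat.exists_eq_add_of_le' h2
    rw [hm] at h1 ⊢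
    simp only [Nat.pred_eq_sub_one, Nat.add_sub_cancel] at h1
    rw [pow_succ]; omega

/-- With `k = clog 2 t`, `2^(k+2) ≤ 8t ≤ (6t)²`, so `k + 2 ≤ 3 log (6t)`. The argument of the
logarithm, times `e`, is then below `(60 log (6t) / δ)²`, and the square yields the factor 2. -/
lemma log_scale_le_two_mul_theta {t : ℕ} (ht : 1 ≤ t) {δ : ℝ} (hδ : 0 < δ) (hδ1 : δ < 1) :
    1 + Real.log (2 * ((Nat.clog 2 t : ℝ) + 1) * ((Nat.clog 2 t : ℝ) + 2) / δ) ≤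
      2 * theta t δ := by
  set k : ℝ := (Nat.clog 2 t : ℝ) with hk
  have hk0 : 0 ≤ k := Nat.cast_nonneg _
  have ht' : (1 : ℝ) ≤ t := by exact_mod_cast ht
  have hL := log_six_mul_ge ht
  have hpow : (2 : ℝ) ^ (Nat.clog 2 t) ≤ 2 * t := by exact_mod_cast two_pow_clog_le ht
  have h1 : k * Real.log 2 ≤ Real.log (2 * t) := by
    rw [hk, ← Real.log_pow]
    exact Real.log_le_log (by positivity) hpow
  have h2 : (k + 2) * Real.log 2 ≤ 2 * Real.log (6 * t) := by
    have h3 : Real.log (2 * t) + 2 * Real.log 2 = Real.log (2 * t * 2 ^ 2) := by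
      rw [Real.log_mul (x := 2 * (t : ℝ)) (by positivity) (by norm_num), Real.log_pow]
      norm_num
    have h4 : Real.log (2 * t * 2 ^ 2) ≤ Real.log ((6 * t) ^ 2) :=
      Real.log_le_log (by positivity) (by nlinarith)
    rw [Real.log_pow] at h4
    push_cast at h4
    linarith
  have h3 : k + 2 ≤ 3 * Real.log (6 * t) := by nlinarith [Real.log_two_gt_d9]
  have h5 : Real.exp 1 * (2 * (k + 1) * (k + 2) / δ) ≤ (60 * Real.log (6 * t) / δ) ^ 2 := by
    rw [div_pow, mul_div_assoc', div_le_div_iff₀ hδ (by positivity)]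
    have h6 : 2 * (k + 1) * (k + 2) ≤ 18 * Real.log (6 * t) ^ 2 := by nlinarith
    have h7 : Real.exp 1 * (2 * (k + 1) * (k + 2)) ≤ (60 * Real.log (6 * t)) ^ 2 := by
      have := mul_le_mul (Real.exp_one_lt_d9.le.trans (by norm_num : _ ≤ (3 : ℝ))) h6
        (by positivity) (by norm_num)
      nlinarith [sq_nonneg (Real.log (6 * t))]
    have h8 : δ ^ 2 ≤ δ := by nlinarith
    exact mul_le_mul h7 h8 (by positivity) (by positivity)
  calc _ = Real.log (Real.exp 1 * (2 * (k + 1) * (k + 2) / δ)) := by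
        rw [Real.log_mul (Real.exp_pos 1).ne' (by positivity), Real.log_exp]
    _ ≤ Real.log ((60 * Real.log (6 * t) / δ) ^ 2) := Real.log_le_log (by positivity) h5
    _ = _ := by rw [Real.log_pow, theta]; norm_num

lemma sum_inv_mul_le_one (K : ℕ) :
    ∑ k ∈ Finset.range K, 1 / (((k : ℝ) + 1) * ((k : ℝ) + 2)) ≤ 1 := by
  have : ∑ k ∈ Finset.range K, 1 / (((k : ℝ) + 1) * ((k : ℝ) + 2)) = 1 - 1 / ((K : ℝ) + 1) := by
    induction K with
    | zero => simp
    | succ K ih =>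
      rw [Finset.sum_range_succ, ih]; push_cast; field_simp; ring
  rw [this]
  have : (0 : ℝ) ≤ 1 / ((K : ℝ) + 1) := by positivity
  linarith

/-- Time-uniform bound for martingales with increments bounded by `1`. -/
lemma measure_exists_abs_sum_le {X : ℕ → Ω → ℝ}
    (hX : ∀ i, StronglyMeasurable[ℱ (i + 1)] (X i)) (hb : ∀ i, ∀ᵐ ω ∂P, |X i ω| ≤ 1)
    (hc : ∀ i, P[X i | ℱ i] =ᵐ[P] 0) (T : ℕ) {δ : ℝ} (hδ : 0 < δ) (hδ1 : δ < 1) :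
    P {ω | ∃ t, 1 ≤ t ∧ t ≤ T ∧ ∃ s ≤ t,
      4 * theta t δ * √(t : ℝ) < |∑ i ∈ Finset.range s, X i ω|} ≤ ENNReal.ofReal δ := by
  -- Scale `2^k` receives probability `δ / ((k+1)(k+2))`, shared equally by the two signs; these sum
  -- to at most `δ`.
  set u : ℕ → ℝ := fun k => 1 + Real.log (2 * ((k : ℝ) + 1) * ((k : ℝ) + 2) / δ) with hu
  set B : ℕ → Set Ω := fun k => {ω | ∃ s ≤ 2 ^ k, u k * √((2 ^ k : ℕ) : ℝ) <
    |∑ i ∈ Finset.range s, X i ω|} with hB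
  have hexp : ∀ k, Real.exp (1 - u k) = δ / (2 * ((k : ℝ) + 1) * ((k : ℝ) + 2)) := fun k => by
    rw [hu]
    simp only [sub_add_cancel_left]
    rw [Real.exp_neg, Real.exp_log (by positivity), inv_div]
  have hPB : ∀ k, P (B k) ≤ ENNReal.ofReal (δ * (1 / (((k : ℝ) + 1) * ((k : ℝ) + 2)))) := by
    intro k
    have h1 := measure_exists_lt_sum_le (P := P) hX hb hc (n := 2 ^ k) Nat.one_le_two_pow (u k)
    have h2 := measure_exists_lt_sum_le (P := P) (X := fun i => -X i) (fun i => (hX i).neg)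
      (fun i => by simpa using hb i)
      (fun i => (condExp_neg (X i) (ℱ i)).trans (by
        filter_upwards [hc i] with ω h; simp [h])) (n := 2 ^ k) Nat.one_le_two_pow (u k)
    have hsub : B k ⊆ {ω | ∃ s ≤ 2 ^ k, u k * √((2 ^ k : ℕ) : ℝ) < ∑ i ∈ Finset.range s, X i ω} ∪
        {ω | ∃ s ≤ 2 ^ k, u k * √((2 ^ k : ℕ) : ℝ) < ∑ i ∈ Finset.range s, (-X i) ω} := by
      rintro ω ⟨s, hs, h⟩
      rcases lt_abs.1 h with h | h
      · exact Or.inl ⟨s, hs, h⟩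
      · exact Or.inr ⟨s, hs, by simpa using h⟩
    refine (measure_mono hsub).trans ((measure_union_le _ _).trans ((add_le_add h1 h2).trans ?_))
    rw [← ENNReal.ofReal_add (Real.exp_pos _).le (Real.exp_pos _).le, hexp]
    refine ENNReal.ofReal_le_ofReal (le_of_eq ?_)
    field_simp; ring
  have hsub : {ω | ∃ t, 1 ≤ t ∧ t ≤ T ∧ ∃ s ≤ t,
      4 * theta t δ * √(t : ℝ) < |∑ i ∈ Finset.range s, X i ω|} ⊆
      ⋃ k ∈ Finset.range (T + 1), B k := by
    rintro ω ⟨t, ht1, htT, s, hst, h⟩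
    -- Time `t` is charged to the least power of two above it, which is at most `2t`; hence `2θ ·
    -- 2√t`.
    have hkt : t ≤ 2 ^ Nat.clog 2 t := Nat.le_pow_clog (by norm_num) t
    refine Set.mem_biUnion (x := Nat.clog 2 t) ?_ ⟨s, hst.trans hkt, lt_of_le_of_lt ?_ h⟩
    · have : Nat.clog 2 t ≤ t := Nat.clog_le_of_le_pow Nat.lt_two_pow_self.le
      exact Finset.mem_coe.2 (Finset.mem_range.2 (by omega))
    · have hpow : ((2 ^ Nat.clog 2 t : ℕ) : ℝ) ≤ 2 * t := by exact_mod_cast two_pow_clog_le ht1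
      have h1 : √((2 ^ Nat.clog 2 t : ℕ) : ℝ) ≤ 2 * √(t : ℝ) := by
        rw [Real.sqrt_le_left (by positivity), mul_pow, Real.sq_sqrt (Nat.cast_nonneg t)]
        have : (0 : ℝ) ≤ t := Nat.cast_nonneg t
        linarith
      have h2 := log_scale_le_two_mul_theta ht1 hδ hδ1
      have h3 := one_le_theta ht1 hδ hδ1
      calc u (Nat.clog 2 t) * √((2 ^ Nat.clog 2 t : ℕ) : ℝ) ≤ (2 * theta t δ) * (2 * √(t : ℝ)) :=
            mul_le_mul h2 h1 (Real.sqrt_nonneg _) (by linarith)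
        _ = _ := by ring
  refine (measure_mono hsub).trans ((measure_biUnion_finset_le _ _).trans
    ((Finset.sum_le_sum fun k _ => hPB k).trans ?_))
  rw [← ENNReal.ofReal_sum_of_nonneg fun k _ => by positivity, ← Finset.mul_sum]
  refine ENNReal.ofReal_le_ofReal ?_
  have := sum_inv_mul_le_one (T + 1)
  nlinarith

/-- Time-uniform bound for the compensated sums of bounded adapted variables. -/
lemma measure_exists_abs_sum_sub_condExp_le {Y : ℕ → Ω → ℝ} {R : ℝ} (hR : 0 ≤ R)
    (hY : ∀ i, StronglyMeasurable[ℱ (i + 1)] (Y i)) (hb : ∀ i, ∀ᵐ ω ∂P, |Y i ω| ≤ R)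
    (T : ℕ) {δ : ℝ} (hδ : 0 < δ) (hδ1 : δ < 1) :
    P {ω | ∃ t, 1 ≤ t ∧ t ≤ T ∧ ∃ s ≤ t, 8 * R * theta t δ * √(t : ℝ) <
      |∑ i ∈ Finset.range s, (Y i ω - (P[Y i | ℱ i]) ω)|} ≤ ENNReal.ofReal δ := by
  have hYi : ∀ i, Integrable (Y i) P := fun i =>
    Integrable.of_bound ((hY i).mono (ℱ.le _)).aestronglyMeasurable R (hb i)
  have hdiff : ∀ i, ∀ᵐ ω ∂P, |Y i ω - (P[Y i | ℱ i]) ω| ≤ 2 * R := fun i => by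
    filter_upwards [hb i, ae_bdd_abs_condExp_of_ae_bdd_abs (m := ℱ i) (hb i)] with ω h1 h2
    refine (abs_sub _ _).trans ?_
    linarith
  set X : ℕ → Ω → ℝ := fun i => (2 * R)⁻¹ • (Y i - P[Y i | ℱ i]) with hXdef
  have hX : ∀ i, StronglyMeasurable[ℱ (i + 1)] (X i) := fun i =>
    ((hY i).sub (stronglyMeasurable_condExp.mono (ℱ.mono (Nat.le_succ i)))).const_smul _
  have hXb : ∀ i, ∀ᵐ ω ∂P, |X i ω| ≤ 1 := fun i => by
    filter_upwards [hdiff i] with ω h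
    simp only [hXdef, Pi.smul_apply, Pi.sub_apply, smul_eq_mul]
    rw [abs_mul, abs_of_nonneg (by positivity : 0 ≤ (2 * R)⁻¹)]
    exact inv_mul_le_one_of_le₀ h (by positivity)
  have hXc : ∀ i, P[X i | ℱ i] =ᵐ[P] 0 := fun i => by
    filter_upwards [condExp_smul (μ := P) (2 * R)⁻¹ (Y i - P[Y i | ℱ i]) (ℱ i),
      condExp_sub (hYi i) (integrable_condExp (m := ℱ i) (f := Y i)) (ℱ i)] with ω h1 h2
    rw [h1, Pi.smul_apply, h2, Pi.sub_apply,
      condExp_of_stronglyMeasurable (ℱ.le i) stronglyMeasurable_condExp integrable_condExp]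
    simp
  have hXY : ∀ᵐ ω ∂P, ∀ i, Y i ω - (P[Y i | ℱ i]) ω = 2 * R * X i ω := by
    filter_upwards [ae_all_iff.2 hdiff] with ω h i
    simp only [hXdef, Pi.smul_apply, Pi.sub_apply, smul_eq_mul]
    -- For `R = 0` the normalization degenerates, but both sides are zero.
    rcases eq_or_lt_of_le hR with h0 | h0
    · have := h i
      rw [← h0, mul_zero] at this
      rw [← h0, abs_nonpos_iff.1 this]; simp
    · rw [mul_inv_cancel_left₀ (by positivity)]
  refine (measure_mono_ae ?_).trans (measure_exists_abs_sum_le hX hXb hXc T hδ hδ1)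
  filter_upwards [hXY] with ω hω
  rintro ⟨t, ht1, htT, s, hst, h⟩
  refine ⟨t, ht1, htT, s, hst, ?_⟩
  simp_rw [hω] at h
  rw [← Finset.mul_sum, abs_mul, abs_of_nonneg (by positivity : 0 ≤ 2 * R)] at h
  refine lt_of_mul_lt_mul_left (a := 2 * R) ?_ (by positivity)
  linarith

end Concentration

end AdaGradPP

namespace AdaGradPP

/-! ### From regret and noise to the rate on one trajectory. -/

variable {d : ℕ}

lemma rate_eq (G ρ : ℝ) (d : ℕ) {T : ℕ} (hT : 1 ≤ T) :
    (G + ρ * √((d : ℝ) / (T : ℝ))) * √((d : ℝ) / (T : ℝ)) =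
      (ρ * d + √(d : ℝ) * G * √(T : ℝ)) / T := by
  have hT0 : (0 : ℝ) < T := by exact_mod_cast hT
  have h1 : √((d : ℝ) / (T : ℝ)) = √(d : ℝ) * √(T : ℝ) / T := by
    rw [Real.sqrt_div (Nat.cast_nonneg d), div_eq_div_iff (Real.sqrt_pos.2 hT0).ne' hT0.ne',
      mul_assoc, Real.mul_self_sqrt hT0.le]
  have h2 : √((d : ℝ) / (T : ℝ)) * √((d : ℝ) / (T : ℝ)) = d / T :=
    Real.mul_self_sqrt (by positivity)
  rw [add_mul, mul_assoc, h2, h1]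
  ring

/-- The sum at index 0 is empty, whereas index 1 already gives a positive value. -/
lemma one_le_of_isOutputIndex {η : ℕ → ℝ} (hη : ∀ t, 0 < η t) {T τ : ℕ} (hT : 1 ≤ T)
    (h : IsOutputIndex η T τ) : 1 ≤ τ := by
  by_contra! h0
  have h1 := h.2 1 hT
  have h2 : τ = 0 := by omega
  subst h2
  simp only [Finset.range_one, Finset.sum_singleton, Finset.range_zero, Finset.sum_empty] at h1
  exact absurd h1 (not_le.2 (div_pos (hη 0) (hη 1)))

/-- Division of the regret bound by the total weight `W`, for which two lower bounds are
available according to whether `L ≤ T`. -/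
lemma le_rate_of_mul_le {W gap D N M a b q Q η₀ θ L T τ : ℝ} (hη₀ : 0 < η₀) (hθ : 1 ≤ θ)
    (hL1 : 1 ≤ L) (hT1 : 1 ≤ T) (hτ1 : 1 ≤ τ) (hD0 : 0 ≤ D) (hDM : D ≤ M) (hηM : η₀ ≤ M)
    (hNM : N ≤ 2 * M) (hηN : η₀ ≤ N) (ha0 : 0 ≤ a) (hb0 : 0 ≤ b) (hq : q = b + a) (hqQ : q ≤ Q)
    (hWpos : 0 < W) (hWL : L ≤ T → N * (T / (6 * L)) ≤ W) (hWτ : η₀ * τ ≤ W)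
    (htotal : W * gap ≤ 1 / 2 * D ^ 2 * q + N ^ 2 * a + 16 * θ * (N * D * a)) :
    gap ≤ 120 * (θ * L / η₀) * (M ^ 2 * (Q / T)) := by
  have hM0 : 0 < M := hη₀.trans_le hηM
  have hN0 : 0 < N := hη₀.trans_le hηN
  have hL0 : 0 < L := by linarith
  have hT0 : 0 < T := by linarith
  have hθ0 : 0 < θ := by linarith
  have hq0 : 0 ≤ q := by linarith
  have hQ0 : 0 ≤ Q := hq0.trans hqQ
  have haq : a ≤ q := by linarith
  have hDsq : D ^ 2 ≤ M ^ 2 := by gcongr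
  -- `1/2 + 2 + 16 ≤ 19` merges the three terms under one scale `Z`, chosen differently in the two
  -- regimes.
  have hcollect : ∀ Z, 0 ≤ Z → D ^ 2 ≤ Z → N ^ 2 ≤ 2 * Z → N * D ≤ Z →
      1 / 2 * D ^ 2 * q + N ^ 2 * a + 16 * θ * (N * D * a) ≤ 19 * θ * (Z * q) := by
    intro Z hZ0 h1 h2 h3
    have hZq : 0 ≤ Z * q := mul_nonneg hZ0 hq0
    have e1 : D ^ 2 * q ≤ Z * q := mul_le_mul_of_nonneg_right h1 hq0
    have e2 : N ^ 2 * a ≤ 2 * Z * q := mul_le_mul h2 haq ha0 (by linarith)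
    have e3 : N * D * a ≤ Z * q := mul_le_mul h3 haq ha0 hZ0
    nlinarith [mul_le_mul_of_nonneg_left e3 (by linarith : 0 ≤ θ),
      mul_le_mul_of_nonneg_right hθ hZq]
  suffices hmain : 1 / 2 * D ^ 2 * q + N ^ 2 * a + 16 * θ * (N * D * a) ≤
      W * (120 * (θ * L / η₀) * (M ^ 2 * (Q / T))) from
    le_of_mul_le_mul_left (htotal.trans hmain) hWpos
  rcases le_or_gt L T with hLT | hLT
  · have hWlow := hWL hLT
    -- The factor `N` in `Z` cancels the one in the lower bound on `W`; inserting it costs the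
    -- `1/η₀` of the rate. The constant is `20 · 6 = 120`.
    have h1 := hcollect (M ^ 2 * N / η₀) (by positivity)
      (hDsq.trans (by rw [le_div_iff₀ hη₀]; gcongr))
      (by
        rw [← mul_div_assoc, le_div_iff₀ hη₀]
        nlinarith [mul_le_mul hNM hηM hη₀.le (by linarith : 0 ≤ 2 * M)])
      (by
        rw [le_div_iff₀ hη₀]
        nlinarith [mul_le_mul hDM hηM hη₀.le hM0.le])
    have hmid : 19 * θ * (M ^ 2 * N / η₀ * q) ≤ 20 * θ * (M ^ 2 * N / η₀ * Q) := by
      have hz : 0 ≤ M ^ 2 * N / η₀ := by positivity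
      exact mul_le_mul (by linarith) (mul_le_mul_of_nonneg_left hqQ hz) (mul_nonneg hz hq0)
        (by linarith)
    calc _ ≤ _ := h1.trans hmid
      _ = N * (T / (6 * L)) * (120 * (θ * L / η₀) * (M ^ 2 * (Q / T))) := by
          field_simp; ring
      _ ≤ _ := mul_le_mul_of_nonneg_right hWlow (by positivity)
  -- Here `L / T > 1`, so the target is already weak and the crude bound `W ≥ η₀ τ` suffices.
  · have h1 := hcollect (2 * M ^ 2) (by positivity) (by nlinarith) (by nlinarith) (by nlinarith)
    have hqτ : q ≤ τ * Q := hqQ.trans (le_mul_of_one_le_left hQ0 hτ1)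
    have hmid : 19 * θ * (2 * M ^ 2 * q) ≤ 120 * θ * (M ^ 2 * (τ * Q)) * (L / T) := by
      have hz : 0 ≤ M ^ 2 := by positivity
      have e1 := mul_le_mul_of_nonneg_left hqτ hz
      have e2 : 0 ≤ θ * (M ^ 2 * (τ * Q)) := by positivity
      have e3 : 1 ≤ L / T := (one_le_div (by linarith)).2 hLT.le
      have e4 := mul_le_mul_of_nonneg_left e1 (by linarith : 0 ≤ θ)
      nlinarith [mul_le_mul_of_nonneg_left e3 e2]
    calc _ ≤ _ := h1.trans hmid
      _ = η₀ * τ * (120 * (θ * L / η₀) * (M ^ 2 * (Q / T))) := by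
          field_simp
      _ ≤ _ := mul_le_mul_of_nonneg_right hWτ (by positivity)

/-- The suboptimality of the output on a trajectory whose accumulated noise is controlled. -/
lemma suboptimality_le {f : E d → ℝ} (hf : ConvexOn ℝ Set.univ f) (x₀ : E d) {η₀ ρ : ℝ}
    (hη₀ : 0 < η₀) (hρ : 0 ≤ ρ) {G θ : ℝ} (hG : 0 ≤ G) (hθ : 1 ≤ θ) (g v : ℕ → E d)
    (xstar : E d) {T τ : ℕ} (hT : 1 ≤ T) (hτ : IsOutputIndex (stepSize x₀ η₀ ρ g) T τ)
    (hg : ∀ t < T, ‖g t‖ ≤ G)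
    (hv : ∀ t < T, v t ∈ subdifferential f (iterate x₀ η₀ ρ g t))
    (hnoise : |∑ t ∈ Finset.range τ, stepSize x₀ η₀ ρ g t *
      inner ℝ (g t - v t) (iterate x₀ η₀ ρ g t - xstar)| ≤
        16 * θ * (stepSize x₀ η₀ ρ g τ * maxDist (iterate x₀ η₀ ρ g) xstar τ *
          (√(d : ℝ) * G * √(τ : ℝ)))) :
    f (average (stepSize x₀ η₀ ρ g) (iterate x₀ η₀ ρ g) τ) ≤ f xstar +
      120 * (θ * (1 + Real.log (stepSize x₀ η₀ ρ g T / η₀)) / η₀) *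
        ((max (maxDist (iterate x₀ η₀ ρ g) xstar τ) η₀) ^ 2 *
          (G + ρ * √((d : ℝ) / (T : ℝ))) * √((d : ℝ) / (T : ℝ))) := by
  have hmono := monotone_stepSize x₀ η₀ ρ g
  have hge : ∀ t, η₀ ≤ stepSize x₀ η₀ ρ g t := fun t => hmono (Nat.zero_le t)
  have hpos : ∀ t, 0 < stepSize x₀ η₀ ρ g t := fun t => hη₀.trans_le (hge t)
  have hτ1 : 1 ≤ τ := one_le_of_isOutputIndex hpos hT hτ
  have hτT : τ ≤ T := hτ.1
  have hT1 : (1 : ℝ) ≤ T := by exact_mod_cast hT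
  have hτ1' : (1 : ℝ) ≤ τ := by exact_mod_cast hτ1
  have hregret := weighted_regret_le x₀ g xstar hη₀ hρ hG τ (fun t ht => hg t (by omega))
  have hstep := stepSize_le x₀ (η₀ := η₀) ρ g xstar τ
  have havg := sum_mul_sub_ge_of_average hf hpos (iterate x₀ η₀ ρ g) hτ1 (f xstar)
  have hblock := exists_sum_div_ge hmono (hpos 0) (T := T)
  rw [show stepSize x₀ η₀ ρ g 0 = η₀ from rfl] at hblock
  set L := 1 + Real.log (stepSize x₀ η₀ ρ g T / η₀) with hL
  have hL1 : 1 ≤ L := by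
    have := Real.log_nonneg ((one_le_div hη₀).2 (hge T))
    linarith
  set D := maxDist (iterate x₀ η₀ ρ g) xstar τ with hD
  have hD0 : 0 ≤ D := maxDist_nonneg _ _ _
  set N := stepSize x₀ η₀ ρ g τ with hN
  set W := ∑ t ∈ Finset.range τ, stepSize x₀ η₀ ρ g t with hW
  have hWpos : 0 < W := Finset.sum_pos (fun t _ => hpos t) (Finset.nonempty_range_iff.2 (by omega))
  have hsub : ∑ t ∈ Finset.range τ, stepSize x₀ η₀ ρ g t * (f (iterate x₀ η₀ ρ g t) - f xstar) ≤
      ∑ t ∈ Finset.range τ, stepSize x₀ η₀ ρ g t *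
        inner ℝ (g t) (iterate x₀ η₀ ρ g t - xstar) -
      ∑ t ∈ Finset.range τ, stepSize x₀ η₀ ρ g t *
        inner ℝ (g t - v t) (iterate x₀ η₀ ρ g t - xstar) := by
    rw [← Finset.sum_sub_distrib]
    refine Finset.sum_le_sum fun t ht => ?_
    have h1 := hv t ((Finset.mem_range.1 ht).trans_le hτT) xstar
    rw [← mul_sub, inner_sub_left, sub_sub_cancel]
    refine mul_le_mul_of_nonneg_left ?_ (hpos t).le
    rw [← neg_sub (iterate x₀ η₀ ρ g t) xstar, inner_neg_right] at h1
    linarith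
  set a := √(d : ℝ) * G * √(τ : ℝ) with ha
  have ha0 : 0 ≤ a := by positivity
  have hρd : 0 ≤ ρ * d := by positivity
  have htotal : W * (f (average (stepSize x₀ η₀ ρ g) (iterate x₀ η₀ ρ g) τ) - f xstar) ≤
      1 / 2 * D ^ 2 * (ρ * d + a) + N ^ 2 * a + 16 * θ * (N * D * a) := by
    linarith [(abs_le.1 hnoise).1]
  set M := max D η₀ with hM
  have hDM : D ≤ M := le_max_left _ _
  have hηM : η₀ ≤ M := le_max_right _ _
  have hNM : N ≤ 2 * M := hstep.trans (max_le (by linarith) (by linarith))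
  have hηN : η₀ ≤ N := hge τ
  have hN0 : 0 < N := hpos τ
  set Q := ρ * d + √(d : ℝ) * G * √(T : ℝ) with hQ
  have hqQ : ρ * d + a ≤ Q := by
    have : √(τ : ℝ) ≤ √(T : ℝ) := Real.sqrt_le_sqrt (by exact_mod_cast hτT)
    have := mul_le_mul_of_nonneg_left this (by positivity : 0 ≤ √(d : ℝ) * G)
    linarith
  have hWL : L ≤ T → N * (T / (6 * L)) ≤ W := fun hLT => by
    obtain ⟨t, htT, ht⟩ := hblock hLT
    have h1 := ht.trans (hτ.2 t htT)
    rw [← Finset.sum_div, le_div_iff₀ hN0] at h1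
    linarith
  have hWτ : η₀ * τ ≤ W := by
    have := Finset.card_nsmul_le_sum (Finset.range τ) (stepSize x₀ η₀ ρ g) η₀ (fun t _ => hge t)
    rw [Finset.card_range, nsmul_eq_mul] at this
    linarith
  have hgap := le_rate_of_mul_le hη₀ hθ hL1 hT1 hτ1' hD0 hDM hηM hNM hηN ha0 hρd rfl hqQ hWpos
    hWL hWτ htotal
  rw [mul_assoc (M ^ 2), rate_eq G ρ d hT]
  linarith

/-! ### Measurability and the probabilistic conclusion. -/

/-- Only `g_k` with `k < t` enter `x_t` and `η_t`. Applied with the σ-algebra `ℱ t`, this lets the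
normalized direction leave the conditional expectation of its product with `g_t`. -/
lemma measurable_iterate_stepSize {Ω : Type*} {m : MeasurableSpace Ω} (x₀ : E d) (η₀ ρ : ℝ)
    {g : ℕ → Ω → E d} {t : ℕ} (hg : ∀ k < t, Measurable (g k)) :
    Measurable (fun ω => iterate x₀ η₀ ρ (fun k => g k ω) t) ∧
      Measurable (fun ω => stepSize x₀ η₀ ρ (fun k => g k ω) t) := by
  induction t with
  | zero => exact ⟨measurable_const, measurable_const⟩
  | succ t ih =>
    obtain ⟨h1, h2⟩ := ih fun k hk => hg k (by omega)
    have hcoord : ∀ {z : Ω → E d}, Measurable z → ∀ i, Measurable (fun ω => z ω i) :=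
      fun hz i => (measurable_pi_apply i).comp ((WithLp.measurable_ofLp 2 _).comp hz)
    have hacc : ∀ i, Measurable (fun ω => accum (fun k => g k ω) t i) := fun i =>
      (Finset.measurable_fun_sum _ fun k hk =>
        (hcoord (hg k (Finset.mem_range.1 hk)) i).pow_const 2).sqrt
    have h3 : Measurable (fun ω => iterate x₀ η₀ ρ (fun k => g k ω) (t + 1)) :=
      (WithLp.measurable_toLp 2 _).comp (measurable_pi_iff.2 fun i =>
        (hcoord h1 i).sub (h2.mul (((hacc i).const_add ρ).inv.mul (hcoord (hg t (by omega)) i))))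
    exact ⟨h3, h2.max ((h3.sub_const x₀).norm.div_const _)⟩

lemma measurable_maxDist {Ω : Type*} {m : MeasurableSpace Ω} {x : ℕ → Ω → E d} {τ : ℕ}
    (hx : ∀ t ≤ τ, Measurable (x t)) (xstar : E d) :
    Measurable (fun ω => maxDist (fun t => x t ω) xstar τ) := by
  have h : ∀ t ∈ Finset.range (τ + 1), Measurable (fun ω => linfNorm (x t ω - xstar)) :=
    fun t ht => measurable_norm.comp ((WithLp.measurable_ofLp 2 _).comp
      ((hx t (Nat.lt_succ_iff.1 (Finset.mem_range.1 ht))).sub_const xstar))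
  have := Finset.measurable_sup' Finset.nonempty_range_add_one h
  have he : (fun ω => maxDist (fun t => x t ω) xstar τ) =
      (Finset.range (τ + 1)).sup' Finset.nonempty_range_add_one
        (fun t ω => linfNorm (x t ω - xstar)) := by
    ext ω
    rw [Finset.sup'_apply, maxDist]
  rwa [he]

/-- The high-probability suboptimality bound of AdaGrad++ with an explicit constant. -/
lemma one_sub_le_measureReal_suboptimality {Ω : Type*} {mΩ : MeasurableSpace Ω} {P : Measure Ω}
    [IsProbabilityMeasure P] {ℱ : Filtration ℕ mΩ} {T : ℕ} (hT : 1 ≤ T) {f l : E d → ℝ}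
    (hf : ConvexOn ℝ Set.univ f) {G : ℝ} (hl : ∀ y, l y ≤ G) {x₀ : E d} {η₀ ρ : ℝ}
    (hη₀ : 0 < η₀) (hρ : 0 ≤ ρ) {x g : ℕ → Ω → E d} {η : ℕ → Ω → ℝ}
    (hx : ∀ t ω, x t ω = iterate x₀ η₀ ρ (fun k => g k ω) t)
    (hη : ∀ t ω, η t ω = stepSize x₀ η₀ ρ (fun k => g k ω) t)
    (hrun : IsOracleRun P ℱ f l T x g) {δ : ℝ} (hδ : 0 < δ) (hδ1 : δ < 1) (xstar : E d) :
    1 - δ ≤ P.real {ω | ∀ τ : ℕ, IsOutputIndex (fun t => η t ω) T τ →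
      f (average (fun t => η t ω) (fun t => x t ω) τ) ≤ f xstar +
        120 * (theta τ δ * (1 + Real.log (η T ω / η₀)) / η₀) *
          ((max (maxDist (fun t => x t ω) xstar τ) η₀) ^ 2 *
            (G + ρ * √((d : ℝ) / (T : ℝ))) * √((d : ℝ) / (T : ℝ)))} := by
  have hgG : ∀ t < T, ∀ᵐ ω ∂P, ‖g t ω‖ ≤ G := fun t ht => by
    filter_upwards [hrun.bounded t ht] with ω h using h.trans (hl _)
  have hG : 0 ≤ G := by
    obtain ⟨ω, hω⟩ := (hgG 0 hT).exists
    exact (norm_nonneg _).trans hω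
  have hxm : ∀ t ≤ T, Measurable[ℱ t] (x t) := fun t ht => by
    have := (measurable_iterate_stepSize (m := ℱ t) x₀ η₀ ρ (g := g) (t := t) fun k hk =>
      ((hrun.measurable k (hk.trans_le ht)).mono (ℱ.mono hk)).measurable).1
    rwa [show x t = _ from funext (hx t)]
  have hDm : ∀ t ≤ T, Measurable[ℱ t] (fun ω => maxDist (fun s => x s ω) xstar t) := fun t ht =>
    measurable_maxDist (m := ℱ t) (fun s hs => (hxm s (hs.trans ht)).mono (ℱ.mono hs) le_rfl) xstar
  set w : ℕ → Ω → ℝ := fun t ω => √(d : ℝ) * maxDist (fun s => x s ω) xstar t with hw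
  have hw0 : ∀ t ω, 0 ≤ w t ω := fun t ω => mul_nonneg (Real.sqrt_nonneg _) (maxDist_nonneg _ _ _)
  have hxw : ∀ t ω, ‖x t ω - xstar‖ ≤ w t ω := fun t ω =>
    (norm_le_sqrt_mul_linfNorm _).trans (mul_le_mul_of_nonneg_left
      (linfNorm_sub_le_maxDist (fun s => x s ω) xstar le_rfl) (Real.sqrt_nonneg _))
  -- If `w_t = 0` then `x_t = x_*`, so the default inverse 0 still gives `w_t • z_t = x_t - x_*`.
  set z : ℕ → Ω → E d := fun t ω => (w t ω)⁻¹ • (x t ω - xstar) with hz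
  have hz1 : ∀ t ω, ‖z t ω‖ ≤ 1 := fun t ω => by
    rw [hz]
    simp only [norm_smul, norm_inv, Real.norm_eq_abs, abs_of_nonneg (hw0 t ω)]
    exact inv_mul_le_one_of_le₀ (hxw t ω) (hw0 t ω)
  have hwz : ∀ t ω, w t ω • z t ω = x t ω - xstar := fun t ω => by
    rcases eq_or_ne (w t ω) 0 with h | h
    · have h1 := hxw t ω
      rw [h] at h1
      rw [h, zero_smul, norm_le_zero_iff.1 h1]
    · exact smul_inv_smul₀ h _
  have hzm : ∀ t ≤ T, StronglyMeasurable[ℱ t] (z t) := fun t ht =>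
    (((hDm t ht).const_mul _).inv.smul ((hxm t ht).sub_const xstar)).stronglyMeasurable
  -- The oracle is constrained only before `T`; extension by zero meets the all-time hypotheses of
  -- the concentration bound.
  set Y : ℕ → Ω → ℝ := fun t ω => if t < T then inner ℝ (z t ω) (g t ω) else 0 with hY
  have hYm : ∀ t, StronglyMeasurable[ℱ (t + 1)] (Y t) := fun t => by
    by_cases ht : t < T
    · simp only [hY, if_pos ht]
      exact ((hzm t ht.le).mono (ℱ.mono (Nat.le_succ t))).inner (hrun.measurable t ht)
    · simp only [hY, if_neg ht]
      exact stronglyMeasurable_const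
  have hYb : ∀ t, ∀ᵐ ω ∂P, |Y t ω| ≤ G := fun t => by
    by_cases ht : t < T
    · filter_upwards [hgG t ht] with ω h
      simp only [hY, if_pos ht]
      refine (abs_real_inner_le_norm _ _).trans ?_
      nlinarith [hz1 t ω, norm_nonneg (z t ω), norm_nonneg (g t ω)]
    · simp [hY, if_neg ht, hG]
  have hcond : ∀ t < T, ∀ᵐ ω ∂P, (P[Y t | ℱ t]) ω = inner ℝ (z t ω) ((P[g t | ℱ t]) ω) := by
    intro t ht
    have hgi : Integrable (g t) P :=
      Integrable.of_bound ((hrun.measurable t ht).mono (ℱ.le _)).aestronglyMeasurable G (hgG t ht)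
    have h := condExp_stronglyMeasurable_bilin_of_bound (μ := P) (innerSL ℝ) (ℱ.le t)
      (hzm t ht.le) hgi 1 (ae_of_all _ (hz1 t))
    have hYe : Y t = fun ω => innerSL ℝ (z t ω) (g t ω) := by
      funext ω; simp only [hY, if_pos ht]; rfl
    rw [hYe]
    exact h
  have hprob := measure_exists_abs_sum_sub_condExp_le hG hYm hYb T hδ hδ1
  set S : Set Ω := {ω | ∀ τ : ℕ, IsOutputIndex (fun t => η t ω) T τ →
    f (average (fun t => η t ω) (fun t => x t ω) τ) ≤ f xstar +
      120 * (theta τ δ * (1 + Real.log (η T ω / η₀)) / η₀) *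
        ((max (maxDist (fun t => x t ω) xstar τ) η₀) ^ 2 *
          (G + ρ * √((d : ℝ) / (T : ℝ))) * √((d : ℝ) / (T : ℝ)))} with hS
  have hSc : P Sᶜ ≤ ENNReal.ofReal δ := by
    refine (measure_mono_ae ?_).trans hprob
    have hall : ∀ᵐ ω ∂P, ∀ t < T, ‖g t ω‖ ≤ G ∧ (P[g t | ℱ t]) ω ∈ subdifferential f (x t ω) ∧
        (P[Y t | ℱ t]) ω = inner ℝ (z t ω) ((P[g t | ℱ t]) ω) := by
      refine ae_all_iff.2 fun t => ?_
      by_cases ht : t < T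
      · filter_upwards [hgG t ht, hrun.unbiased t ht, hcond t ht] with ω h1 h2 h3 _
        exact ⟨h1, h2, h3⟩
      · exact ae_of_all _ fun ω h => absurd h ht
    filter_upwards [hall] with ω hω hωS
    by_contra hbad
    refine hωS fun τ hτ => ?_
    have hxω : (fun t => x t ω) = iterate x₀ η₀ ρ (fun k => g k ω) := funext fun t => hx t ω
    have hηω : (fun t => η t ω) = stepSize x₀ η₀ ρ (fun k => g k ω) := funext fun t => hη t ω
    have hmono : Monotone (fun t => η t ω) := hηω ▸ monotone_stepSize x₀ η₀ ρ _
    have hηpos : ∀ t, 0 < η t ω := fun t => by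
      have h1 := hmono (Nat.zero_le t)
      have h2 : η 0 ω = η₀ := hη 0 ω
      simp only [h2] at h1
      linarith
    have hτ1 : 1 ≤ τ := one_le_of_isOutputIndex hηpos hT hτ
    have hB : ∀ s ≤ τ, |∑ i ∈ Finset.range s, (Y i ω - (P[Y i | ℱ i]) ω)| ≤
        8 * G * theta τ δ * √(τ : ℝ) := fun s hs => by
      by_contra! hlt
      exact hbad ⟨τ, hτ1, hτ.1, s, hs, hlt⟩
    have hwmono : Monotone (fun t => w t ω) := fun a b hab =>
      mul_le_mul_of_nonneg_left (monotone_maxDist (fun s => x s ω) xstar hab) (Real.sqrt_nonneg _)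
    -- The factor 2 of summation by parts turns the constant 8 into the 16 of `hnoise`.
    have habel := abs_sum_mul_le_of_monotone (y := fun t => η t ω * w t ω)
      (fun a b hab => mul_le_mul (hmono hab) (hwmono hab) (hw0 a ω) (hηpos b).le)
      (mul_nonneg (hηpos 0).le (hw0 0 ω)) τ hB
    have hsum : ∑ t ∈ Finset.range τ, η t ω * w t ω * (Y t ω - (P[Y t | ℱ t]) ω) =
        ∑ t ∈ Finset.range τ, η t ω * inner ℝ (g t ω - (P[g t | ℱ t]) ω) (x t ω - xstar) := by
      refine Finset.sum_congr rfl fun t ht => ?_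
      have htT : t < T := (Finset.mem_range.1 ht).trans_le hτ.1
      rw [(hω t htT).2.2, ← hwz t ω, inner_smul_right, inner_sub_left,
        real_inner_comm (z t ω) (g t ω), real_inner_comm (z t ω) ((P[g t | ℱ t]) ω)]
      simp only [hY, if_pos htT]
      ring
    rw [hsum] at habel
    have hres := suboptimality_le hf x₀ hη₀ hρ hG (one_le_theta hτ1 hδ hδ1) (fun k => g k ω)
      (fun t => (P[g t | ℱ t]) ω) xstar hT (hηω ▸ hτ) (fun t ht => (hω t ht).1)
      (fun t ht => by rw [← hx t ω]; exact (hω t ht).2.1) (by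
        rw [← hηω, ← hxω]
        refine habel.trans (le_of_eq ?_)
        simp only [hw]
        ring)
    rw [← hηω, ← hxω] at hres
    exact hres
  -- Subadditivity avoids having to show that the event `S` is measurable.
  have h1 : (1 : ENNReal) ≤ P S + P Sᶜ := by
    rw [← measure_univ (μ := P), ← Set.union_compl_self S]
    exact measure_union_le _ _
  have h2 : 1 ≤ P.real S + P.real Sᶜ := by
    have := ENNReal.toReal_mono (by finiteness) h1
    rwa [ENNReal.toReal_add (by finiteness) (by finiteness), ENNReal.toReal_one] at this
  have h3 : P.real Sᶜ ≤ δ := ENNReal.toReal_le_of_le_ofReal hδ.le hSc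
  linarith

end AdaGradPP

theorem corollary1 :
    ∃ C : ℝ, 0 < C ∧
      ∀ (Ω : Type*) (mΩ : MeasurableSpace Ω) (P : Measure Ω) (_ : IsProbabilityMeasure P)
        (ℱ : Filtration ℕ mΩ) (d T : ℕ) (_ : 1 ≤ T)
        (f l : AdaGradPP.E d → ℝ) (_ : ConvexOn ℝ Set.univ f) (_ : Continuous l)
        (G : ℝ) (_ : ∀ y, l y ≤ G)
        (x₀ : AdaGradPP.E d) (η₀ ρ : ℝ) (_ : 0 < η₀) (_ : 0 ≤ ρ)
        (x g : ℕ → Ω → AdaGradPP.E d) (η : ℕ → Ω → ℝ)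
        (_ : ∀ t ω, x t ω = AdaGradPP.iterate x₀ η₀ ρ (fun k => g k ω) t)
        (_ : ∀ t ω, η t ω = AdaGradPP.stepSize x₀ η₀ ρ (fun k => g k ω) t)
        (_ : AdaGradPP.IsOracleRun P ℱ f l T x g)
        (δ : ℝ) (_ : 0 < δ) (_ : δ < 1) (xstar : AdaGradPP.E d),
        1 - δ ≤ P.real {ω | ∀ τ : ℕ, AdaGradPP.IsOutputIndex (fun t => η t ω) T τ →
          f (AdaGradPP.average (fun t => η t ω) (fun t => x t ω) τ) ≤ f xstar +
            C * (AdaGradPP.theta τ δ * (1 + Real.log (η T ω / η₀)) / η₀) *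
              ((max (AdaGradPP.maxDist (fun t => x t ω) xstar τ) η₀) ^ 2 *
                (G + ρ * √((d : ℝ) / (T : ℝ))) * √((d : ℝ) / (T : ℝ)))} := by
  refine ⟨120, by norm_num, ?_⟩
  intro Ω mΩ P _ ℱ d T hT f l hf _ G hl x₀ η₀ ρ hη₀ hρ x g η hx hη hrun δ hδ hδ1 xstar
  exact AdaGradPP.one_sub_le_measureReal_suboptimality hT hf hl hη₀ hρ hx hη hrun hδ hδ1 xstar
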